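/- Read the language of recursive constructive mathematics (Bishop-style constructive mathematics together with the Church–Markov–Turing thesis, CMT) in its recursive model, i.e. through Kleene's number realizability: a proposition is true if it has a realizer; $A\wedge B$ is realized by pairs; $A\Rightarrow B$ by programs turning realizers of $A$ into realizers of $B$; $\forall x\in S$ by programs turning each name of each $x\in S$ into a realizer; $\exists x\in S$ by a name of some $x\in S$ together with a realizer. A name of a real number $x$ is a program for a sequence of rationals $(q_n)_{n\ge 0}$ with $|x-q_n|\le 1/(n+1)$; a realizer of $x<y$ is an $n$ with $1/(n+1)<y-x$; $x\le y$ means $\neg(y<x)$; $x=y$ means $x\le y$ and $y\le x$; a name of a function is a program turning names of arguments into names of values. CMT says that for each $\alpha:\mathbf N\to\mathbf N$ there is a program computing $\alpha$. For $f:X\to\mathbf R$, $X\subset\mathbf R$, let $Z_f=\{x\in X: f(x)=0\}$, and let $\rho(x,Z_f)<\varepsilon$ mean that there is $y\in Z_f$ with $|x-y|<\varepsilon$. The map $f$ is Z-stable if for each $x\in X$ and each $\varepsilon>0$ there is $\delta>0$ such that $|f(x)|<\delta$ implies $\rho(x,Z_f)<\varepsilon$. It is uniformly Z-stable if for each $\varepsilon>0$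 there is $\delta>0$ such that for each $x\in X$, $|f(x)|<\delta$ implies $\rho(x,Z_f)<\varepsilon$. A subset $S$ of $X$ is located in $X$ if for each $x\in X$ the distance $\inf\{|x-y|:y\in S\}$ exists, where $m=\inf_{y\in S}\varphi(y)$ means that $m\le\varphi(y)$ for all $y\in S$ and that for each $\varepsilon>0$ there is $y\in S$ with $\varphi(y)<m+\varepsilon$. Then CMT is true in this model, and so is the following statement. If CMT holds, then there is a uniformly continuous function $g:[0,1/2]\to\mathbf R$ with $g(x)>0$ for all $x$ and $\inf_{[0,1/2]} g=0$, and there is a function $f:[0,1]\to\mathbf R$ with nonnegative values such that 1. $f=g$ on $[0,1/2]$, $f(1)=0$, and $f$ is linear on $[1/2,1]$, i.e. $f(x)=(2-2x)f(1/2)+(2x-1)f(1)$ there; 2. $Z_f=\{1\}$, and $Z_f$ is inhabited and located in $[0,1]$; 3. $f$ is uniformly continuous and Z-stable on $[0,1]$; 4. $f$ is not uniformly Z-stable on $[0,1]$. -/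

import Mathlib

/-!  Recursive constructive mathematics, that is, constructive mathematics together with the
Church–Markov–Turing thesis, read through Kleene's number realizability.  A proposition is
interpreted by the set of its realizers, a set is interpreted by the realizers (names) of its
elements, the connectives and quantifiers have their usual computational meaning, and a proposition
is true in the model when it has a realizer.  Everything below the interpretation of the logic
is written with these connectives and quantifiers only. -/

namespace RecursiveModel

/-! ### Logic -/

/-- Kleene application: the result, if any, of the `e`-th program on the input `n`. -/
def app (e n : ℕ) : Part ℕ := (Denumerable.ofNat Nat.Partrec.Code e).eval n

/-- A proposition of the model, given by its set of realizers. -/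
abbrev RProp : Type := ℕ → Prop

/-- Truth in the model. -/
def Holds (A : RProp) : Prop := ∃ e, A e

/-- A proposition without computational content (used for decidable statements about numbers). -/
def atom (P : Prop) : RProp := fun _ => P

def conj (A B : RProp) : RProp := fun e => A e.unpair.1 ∧ B e.unpair.2

def impl (A B : RProp) : RProp := fun e => ∀ a, A a → ∃ b ∈ app e a, B b

def neg (A : RProp) : RProp := impl A (atom False)

infixr:35 " ⋏ " => conj
infixr:30 " ⟹ " => impl

def iff (A B : RProp) : RProp := (A ⟹ B) ⋏ (B ⟹ A)

/-- A set of the model on an underlying type `X`: `A x e` says that `e` is a name of the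
element `x` of `A` (as a proposition, `A x` says that `x` belongs to `A`). An `x` without a name
is not an element of `A`. -/
abbrev RSet (X : Type) : Type := X → RProp

/-- `∀ x ∈ A, P x`: a realizer turns each name of each `x` into a realizer of `P x`. -/
def forAll {X : Type} (A : RSet X) (P : X → RProp) : RProp :=
  fun e => ∀ x n, A x n → ∃ m ∈ app e n, P x m

/-- `∃ x ∈ A, P x`: a realizer consists of a name of some `x` and a realizer of `P x`. -/
def exist {X : Type} (A : RSet X) (P : X → RProp) : RProp :=
  fun e => ∃ x, A x e.unpair.1 ∧ P x e.unpair.2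

/-- The subset `{x ∈ A | P x}`. -/
def sep {X : Type} (A : RSet X) (P : X → RProp) : RSet X := fun x => A x ⋏ P x

/-- The set of functions from `A` to `B`; a name of `f` is a program that turns names of `x`
into names of `f x`. The values of `f` outside `A` are immaterial. -/
def fn {X Y : Type} (A : RSet X) (B : RSet Y) : RSet (X → Y) :=
  fun f e => ∀ x n, A x n → ∃ m ∈ app e n, B (f x) m

/-! ### Numbers -/

/-- The natural numbers; each is named by itself. -/
def nat : RSet ℕ := fun k n => n = k

/-- The rational number `(a - b) / (c + 1)` with code `⟨a, ⟨b, c⟩⟩`. -/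
def rat (m : ℕ) : ℚ := ((m.unpair.1 : ℚ) - m.unpair.2.unpair.1) / (m.unpair.2.unpair.2 + 1)

/-- The real numbers: a name of `x` is a program for a (regular) sequence `q₀, q₁, …` of
rationals with `|x - qₙ| ≤ 1 / (n + 1)`. -/
def real : RSet ℝ := fun x e => ∀ n, ∃ m ∈ app e n, |x - (rat m : ℝ)| ≤ 1 / ((n : ℝ) + 1)

/-- `x < y`: a realizer is an `n` with `1 / (n + 1) < y - x`. -/
def lt (x y : ℝ) : RProp := fun n => 1 / ((n : ℝ) + 1) < y - x

def le (x y : ℝ) : RProp := neg (lt y x)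

def eq (x y : ℝ) : RProp := le x y ⋏ le y x

/-- The positive reals. -/
def pos : RSet ℝ := sep real fun x => lt 0 x

/-- The interval `[a, b]`. -/
def interval (a b : ℝ) : RSet ℝ := sep real fun x => le a x ⋏ le x b

/-- The Church–Markov–Turing thesis: every function from `ℕ` to `ℕ` is computed by a program, i.e.
for each `α` there is `e` such that for each `n` the `e`-th program halts on `n` within some
number `k` of steps, with output `α n`. -/
def CMT : RProp :=
  forAll (fn nat nat) fun α => exist nat fun e => forAll nat fun n => exist nat fun k =>
    atom (α n ∈ Nat.Partrec.Code.evaln k (Denumerable.ofNat Nat.Partrec.Code e) n)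

/-! ### Analysis, for a real-valued function `f` on a set `X` of reals -/

/-- `m` is the infimum of `φ` over `S`. -/
def IsInfimum (S : RSet ℝ) (φ : ℝ → ℝ) (m : ℝ) : RProp :=
  (forAll S fun x => le m (φ x)) ⋏
  (forAll pos fun ε => exist S fun x => lt (φ x) (m + ε))

def IsInhabited (S : RSet ℝ) : RProp := exist S fun _ => atom True

/-- `S` is located in `X`: the distance `inf {|x - y| : y ∈ S}` exists for each `x ∈ X`. -/
def Located (X S : RSet ℝ) : RProp :=
  forAll X fun x => exist real fun d => IsInfimum S (fun y => |x - y|) d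

/-- `ρ(x, S) < ε`, in the sense that there is `y ∈ S` with `ρ(x, y) < ε`. -/
def DistLt (x : ℝ) (S : RSet ℝ) (ε : ℝ) : RProp := exist S fun y => lt |x - y| ε

/-- The zero set of `f`. -/
def zeros (X : RSet ℝ) (f : ℝ → ℝ) : RSet ℝ := sep X fun x => eq (f x) 0

def UniformlyContinuous (X : RSet ℝ) (f : ℝ → ℝ) : RProp :=
  forAll pos fun ε => exist pos fun δ => forAll X fun x => forAll X fun y =>
    lt |x - y| δ ⟹ lt |f x - f y| ε

def ZStableAt (X : RSet ℝ) (f : ℝ → ℝ) (x : ℝ) : RProp :=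
  forAll pos fun ε => exist pos fun δ => lt |f x| δ ⟹ DistLt x (zeros X f) ε

def ZStable (X : RSet ℝ) (f : ℝ → ℝ) : RProp := forAll X fun x => ZStableAt X f x

def UniformlyZStable (X : RSet ℝ) (f : ℝ → ℝ) : RProp :=
  forAll pos fun ε => exist pos fun δ => forAll X fun x =>
    lt |f x| δ ⟹ DistLt x (zeros X f) ε

end RecursiveModel

open RecursiveModel

/-! The construction rests on a singular cover. If the program `e` names a real x, its output at
index 2^(e+5) - 1 is a rational within 2^-(e+5) of x, so the tent of twice that radius around the
output is positive at x. The computable sum `tents` of all these tents, with geometric weights, is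
therefore positive at every real that has a name (`tents_pos`). The bases have total length at most
1/4, so they miss a classical point of [0, 1/2], where `tents` vanishes (`exists_tents_eq_zero`).
That point has no name and does not exist in the model, but by the Lipschitz bound rational points
near it have arbitrarily small values, and search finds them. Hence g is positive with infimum 0.

`singularMap` multiplies by a ramp that falls to 0 at 1, which becomes the only named zero. Uniform
Z-stability fails because small values occur on [0, 1/2], far from 1. Pointwise Z-stability
survives: δ = f(x) + max(0, r - |x - 1|) is computable and positive at every named x in [0, 1], and
f(x) < δ forces |x - 1| < r (`holds_zStable`).

Realizers come from three tools: search (`exists_pos_search`), the passage from rational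
approximations to programs on names (`EffLip.exists_name`), and the s-m-n theorem (`exists_curry`).
CMT is realized because a name of α already is a program for α. -/

namespace RecursiveModel

/-! ### Computable rational-valued functions -/

section RatComp

variable {α β : Type} [Primcodable α] [Primcodable β]

/-- A rational-valued function with computable codes for its values. -/
def RatComp (φ : α → ℚ) : Prop := ∃ s : α → ℕ, Computable s ∧ ∀ a, rat (s a) = φ a

/-- The code of `(a - b) / (c + 1)`. -/
def ratCode (a b c : ℕ) : ℕ := Nat.pair a (Nat.pair b c)

@[simp] lemma rat_ratCode (a b c : ℕ) : rat (ratCode a b c) = ((a : ℚ) - b) / (c + 1) := by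
  simp [rat, ratCode]

lemma Computable.ratCode {f g h : α → ℕ} (hf : Computable f) (hg : Computable g)
    (hh : Computable h) : Computable fun a => RecursiveModel.ratCode (f a) (g a) (h a) :=
  Primrec₂.natPair.to_comp.comp hf (Primrec₂.natPair.to_comp.comp hg hh)

lemma computable_add {f g : α → ℕ} (hf : Computable f) (hg : Computable g) :
    Computable fun a => f a + g a := Primrec.nat_add.to_comp.comp hf hg

lemma computable_mul {f g : α → ℕ} (hf : Computable f) (hg : Computable g) :
    Computable fun a => f a * g a := Primrec.nat_mul.to_comp.comp hf hg

lemma computable_sub {f g : α → ℕ} (hf : Computable f) (hg : Computable g) :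
    Computable fun a => f a - g a := Primrec.nat_sub.to_comp.comp hf hg

lemma computable_natPair {f g : α → ℕ} (hf : Computable f) (hg : Computable g) :
    Computable fun a => Nat.pair (f a) (g a) := Primrec₂.natPair.to_comp.comp hf hg

lemma computable_unpair_fst {f : α → ℕ} (hf : Computable f) :
    Computable fun a => (f a).unpair.1 := Computable.fst.comp (Computable.unpair.comp hf)

lemma computable_unpair_snd {f : α → ℕ} (hf : Computable f) :
    Computable fun a => (f a).unpair.2 := Computable.snd.comp (Computable.unpair.comp hf)

lemma computable_two_pow {f : α → ℕ} (hf : Computable f) : Computable fun a => 2 ^ f a :=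
  ((Primrec₂.unpaired'.1 Nat.Primrec.pow).to_comp).comp (Computable.const 2) hf

namespace RatComp

variable {φ ψ : α → ℚ}

lemma of_eq (h : RatComp φ) (e : ∀ a, φ a = ψ a) : RatComp ψ := by
  obtain rfl : φ = ψ := funext e
  exact h

lemma comp {φ : β → ℚ} (h : RatComp φ) {f : α → β} (hf : Computable f) :
    RatComp fun a => φ (f a) := by
  obtain ⟨s, hs, e⟩ := h
  exact ⟨fun a => s (f a), hs.comp hf, fun a => e _⟩

lemma rat {f : α → ℕ} (hf : Computable f) : RatComp fun a => rat (f a) := ⟨f, hf, fun _ => rfl⟩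

lemma inv_succ {f : α → ℕ} (hf : Computable f) : RatComp fun a => 1 / ((f a : ℚ) + 1) :=
  ⟨_, Computable.ratCode (.const 1) (.const 0) hf, fun a => by simp⟩

lemma _root_.RecursiveModel.rat_surjective : Function.Surjective RecursiveModel.rat := fun q => by
  refine ⟨ratCode q.num.toNat (-q.num).toNat (q.den - 1), ?_⟩
  have h1 : ((q.num.toNat : ℚ) - (-q.num).toNat) = q.num := by
    exact_mod_cast congrArg (Int.cast (R := ℚ)) (Int.toNat_sub_toNat_neg q.num)
  have h2 : ((q.den - 1 : ℕ) : ℚ) + 1 = q.den := by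
    have := q.pos
    rw [Nat.cast_sub (by omega)]; simp
  rw [rat_ratCode, h1, h2, Rat.num_div_den]

lemma const (q : ℚ) : RatComp fun _ : α => q := by
  obtain ⟨n, rfl⟩ := rat_surjective q
  exact rat (.const n)

lemma add (hφ : RatComp φ) (hψ : RatComp ψ) : RatComp fun a => φ a + ψ a := by
  obtain ⟨s, hs, e⟩ := hφ
  obtain ⟨t, ht, e'⟩ := hψ
  have a1 := computable_unpair_fst hs
  have b1 := computable_unpair_fst (computable_unpair_snd hs)
  have c1 := computable_unpair_snd (computable_unpair_snd hs)
  have a2 := computable_unpair_fst ht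
  have b2 := computable_unpair_fst (computable_unpair_snd ht)
  have c2 := computable_unpair_snd (computable_unpair_snd ht)
  have o : Computable fun _ : α => 1 := .const 1
  refine ⟨_, Computable.ratCode
    (computable_add (computable_mul a1 (computable_add c2 o)) (computable_mul a2 (computable_add c1 o)))
    (computable_add (computable_mul b1 (computable_add c2 o)) (computable_mul b2 (computable_add c1 o)))
    (computable_add (computable_mul c1 c2) (computable_add c1 c2)), fun a => ?_⟩
  beta_reduce
  rw [← e, ← e', rat_ratCode, RecursiveModel.rat, RecursiveModel.rat]
  push_cast
  rw [div_add_div _ _ (by positivity) (by positivity)]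
  congr 1 <;> ring

lemma mul (hφ : RatComp φ) (hψ : RatComp ψ) : RatComp fun a => φ a * ψ a := by
  obtain ⟨s, hs, e⟩ := hφ
  obtain ⟨t, ht, e'⟩ := hψ
  have a1 := computable_unpair_fst hs
  have b1 := computable_unpair_fst (computable_unpair_snd hs)
  have c1 := computable_unpair_snd (computable_unpair_snd hs)
  have a2 := computable_unpair_fst ht
  have b2 := computable_unpair_fst (computable_unpair_snd ht)
  have c2 := computable_unpair_snd (computable_unpair_snd ht)
  refine ⟨_, Computable.ratCode
    (computable_add (computable_mul a1 a2) (computable_mul b1 b2))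
    (computable_add (computable_mul a1 b2) (computable_mul b1 a2))
    (computable_add (computable_mul c1 c2) (computable_add c1 c2)), fun a => ?_⟩
  beta_reduce
  rw [← e, ← e', rat_ratCode, RecursiveModel.rat, RecursiveModel.rat]
  push_cast
  rw [div_mul_div_comm]
  congr 1 <;> ring

lemma neg (hφ : RatComp φ) : RatComp fun a => -φ a :=
  ((const (-1)).mul hφ).of_eq fun a => by ring

lemma sub (hφ : RatComp φ) (hψ : RatComp ψ) : RatComp fun a => φ a - ψ a :=
  (hφ.add hψ.neg).of_eq fun a => by ring

/-- The coded denominator is positive, so the sign of the difference is read off its numerator. -/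
lemma computable_lt (hφ : RatComp φ) (hψ : RatComp ψ) :
    Computable fun a => decide (φ a < ψ a) := by
  obtain ⟨s, hs, e⟩ := hφ.sub hψ
  have h := Primrec.nat_lt.decide.to_comp.comp (computable_unpair_fst hs)
    (computable_unpair_fst (computable_unpair_snd hs))
  refine h.of_eq fun a => ?_
  have : φ a < ψ a ↔ φ a - ψ a < 0 := sub_neg.symm
  rw [decide_eq_decide, this, show φ a - ψ a = _ from (e a).symm, RecursiveModel.rat, div_lt_iff₀ (by positivity), zero_mul,
    sub_neg, Nat.cast_lt]

lemma ite {c : α → Bool} (hc : Computable c) (hφ : RatComp φ) (hψ : RatComp ψ) :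
    RatComp fun a => bif c a then φ a else ψ a := by
  obtain ⟨s, hs, e⟩ := hφ
  obtain ⟨t, ht, e'⟩ := hψ
  refine ⟨_, Computable.cond hc hs ht, fun a => ?_⟩
  beta_reduce
  cases c a <;> simp [e, e']

lemma max (hφ : RatComp φ) (hψ : RatComp ψ) : RatComp fun a => max (φ a) (ψ a) :=
  (ite (hφ.computable_lt hψ) hψ hφ).of_eq fun a => by
    by_cases h : φ a < ψ a
    · simp [h, h.le]
    · simp [h, not_lt.1 h]

lemma min (hφ : RatComp φ) (hψ : RatComp ψ) : RatComp fun a => min (φ a) (ψ a) :=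
  (hφ.neg.max hψ.neg).neg.of_eq fun a => by rw [max_neg_neg, neg_neg]

lemma abs (hφ : RatComp φ) : RatComp fun a => |φ a| := hφ.max hφ.neg

lemma sum {φ : α × ℕ → ℚ} (hφ : RatComp φ) {n : α → ℕ} (hn : Computable n) :
    RatComp fun a => ∑ i ∈ Finset.range (n a), φ (a, i) := by
  -- `t` sends a code of a partial sum to a code of that sum plus the next term; recursion on ℕ
  -- iterates it.
  obtain ⟨t, ht, e⟩ :=
    (rat (α := (α × ℕ) × ℕ) .snd).add (hφ.comp .fst)
  have z : Computable fun _ : α => ratCode 0 0 0 := .const _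
  have step : Computable₂ fun (a : α) (p : ℕ × ℕ) => t ((a, p.1), p.2) :=
    ht.comp ((Computable.fst.pair (Computable.fst.comp .snd)).pair (Computable.snd.comp .snd))
  refine ⟨_, Computable.nat_rec hn z step, fun a => ?_⟩
  beta_reduce
  induction n a with
  | zero => simp
  | succ k ih => rw [Finset.sum_range_succ, ← ih]; exact e _

lemma option {o : α → Option β} (ho : Computable o) {φ : α × β → ℚ} (hφ : RatComp φ)
    (hψ : RatComp ψ) : RatComp fun a => (o a).elim (ψ a) fun b => φ (a, b) := by
  obtain ⟨s, hs, e⟩ := hφ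
  obtain ⟨t, ht, e'⟩ := hψ
  refine ⟨_, Computable.option_casesOn ho ht (g := fun a b => s (a, b)) hs, fun a => ?_⟩
  beta_reduce
  cases h : o a <;> simp [e, e']

end RatComp

end RatComp

/-! ### Realizers -/

lemma partrec_app : Partrec₂ app :=
  Nat.Partrec.Code.eval_part.comp ((Computable.ofNat _).comp .fst) .snd

/-- A program for a constant function. -/
def constName (m : ℕ) : ℕ := Encodable.encode (Nat.Partrec.Code.const m)

@[simp] lemma app_constName (m n : ℕ) : app (constName m) n = Part.some m := by
  simp [app, constName]

lemma computable_constName : Computable constName :=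
  (Primrec.encode.comp Nat.Partrec.Code.primrec_const).to_comp

lemma exists_name {f : ℕ →. ℕ} (hf : Partrec f) : ∃ e, app e = f := by
  obtain ⟨c, rfl⟩ := Nat.Partrec.Code.exists_code.1 (Partrec.nat_iff.1 hf)
  exact ⟨Encodable.encode c, by funext n; simp [app]⟩

/-- The s-m-n theorem, needed wherever a realizer must return a program. -/
lemma exists_curry {f : ℕ → ℕ →. ℕ} (hf : Partrec₂ f) :
    ∃ s : ℕ → ℕ, Computable s ∧ ∀ a b, app (s a) b = f a b := by
  obtain ⟨c, hc⟩ := Nat.Partrec.Code.exists_code.1 (Partrec₂.unpaired'.2 hf)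
  refine ⟨fun a => Encodable.encode (c.curry a), (Primrec.encode.comp
    (Nat.Partrec.Code.primrec₂_curry.comp (.const c) .id)).to_comp, fun a b => ?_⟩
  simp [app, Nat.Partrec.Code.eval_curry, hc]

lemma Holds.conj {A B : RProp} (hA : Holds A) (hB : Holds B) : Holds (A ⋏ B) := by
  obtain ⟨a, ha⟩ := hA
  obtain ⟨b, hb⟩ := hB
  exact ⟨Nat.pair a b, by simpa [RecursiveModel.conj] using ⟨ha, hb⟩⟩

lemma Holds.impl {B : RProp} (A : RProp) (hB : Holds B) : Holds (A ⟹ B) := by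
  obtain ⟨b, hb⟩ := hB
  exact ⟨constName b, fun a _ => ⟨b, by simp, hb⟩⟩

lemma Holds.exist {X : Type} {A : RSet X} {P : X → RProp} (x : X) (hA : Holds (A x))
    (hP : Holds (P x)) : Holds (exist A P) := by
  obtain ⟨a, ha⟩ := hA
  obtain ⟨b, hb⟩ := hP
  exact ⟨Nat.pair a b, x, by simpa using ha, by simpa using hb⟩

lemma Holds.forAll {X : Type} {A : RSet X} {P : X → RProp} {f : ℕ →. ℕ} (hf : Partrec f)
    (h : ∀ x n, A x n → ∃ m ∈ f n, P x m) : Holds (forAll A P) := by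
  obtain ⟨e, rfl⟩ := exists_name hf
  exact ⟨e, h⟩

lemma Holds.forAll_total {X : Type} {A : RSet X} {P : X → RProp} {f : ℕ → ℕ} (hf : Computable f)
    (h : ∀ x n, A x n → P x (f n)) : Holds (RecursiveModel.forAll A P) :=
  Holds.forAll hf.partrec fun x n hx => ⟨f n, Part.mem_some _, h x n hx⟩

lemma forAll_constName {X : Type} {A : RSet X} {P : X → RProp} {m : ℕ}
    (h : ∀ x n, A x n → P x m) : RecursiveModel.forAll A P (constName m) :=
  fun x n hx => ⟨m, by simp, h x n hx⟩

lemma impl_constName {A B : RProp} {m : ℕ} (h : ∀ n, A n → B m) : (A ⟹ B) (constName m) :=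
  fun n hn => ⟨m, by simp, h n hn⟩

lemma conj_pair {A B : RProp} {a b : ℕ} (ha : A a) (hb : B b) : (A ⋏ B) (Nat.pair a b) := by
  simpa [RecursiveModel.conj] using And.intro ha hb

lemma exist_pair {X : Type} {A : RSet X} {P : X → RProp} {a b : ℕ} (x : X) (ha : A x a)
    (hb : P x b) : RecursiveModel.exist A P (Nat.pair a b) :=
  ⟨x, by simpa using ha, by simpa using hb⟩

/-- Negations carry no computational content: once true, every number realizes them. The same
follows for `le` and `eq`, whence the arbitrary zeros in later realizers. -/
lemma neg_iff {A : RProp} {e : ℕ} : neg A e ↔ ¬ Holds A := by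
  constructor
  · rintro h ⟨a, ha⟩
    obtain ⟨b, -, hb⟩ := h a ha
    exact hb
  · exact fun h a ha => (h ⟨a, ha⟩).elim

lemma exists_lt_iff {x y : ℝ} : Holds (lt x y) ↔ x < y := by
  constructor
  · rintro ⟨n, hn⟩
    have : (0 : ℝ) < 1 / ((n : ℝ) + 1) := by positivity
    have hn : 1 / ((n : ℝ) + 1) < y - x := hn
    linarith
  · intro h
    exact exists_nat_one_div_lt (sub_pos.2 h)

lemma lt_of_lt {x y : ℝ} {n : ℕ} (h : lt x y n) : x < y := exists_lt_iff.1 ⟨n, h⟩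

lemma le_iff {x y : ℝ} {e : ℕ} : le x y e ↔ x ≤ y := by
  rw [le, neg_iff, exists_lt_iff, not_lt]

lemma eq_iff {x y : ℝ} {e : ℕ} : eq x y e ↔ x = y := by
  rw [eq, conj, le_iff, le_iff, le_antisymm_iff]

lemma interval_iff {a b x : ℝ} {e : ℕ} :
    interval a b x e ↔ real x e.unpair.1 ∧ a ≤ x ∧ x ≤ b := by
  simp only [interval, sep, conj, le_iff]

lemma zeros_iff {a b x : ℝ} {f : ℝ → ℝ} {e : ℕ} :
    zeros (interval a b) f x e ↔ real x e.unpair.1.unpair.1 ∧ (a ≤ x ∧ x ≤ b) ∧ f x = 0 := by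
  rw [zeros, sep, conj, interval_iff, eq_iff, and_assoc]

lemma pos_iff {x : ℝ} {e : ℕ} :
    pos x e ↔ real x e.unpair.1 ∧ 1 / ((e.unpair.2 : ℝ) + 1) < x := by
  simp [pos, sep, conj, lt]

lemma real_constName (q : ℕ) : real (rat q) (constName q) :=
  fun n => ⟨q, by simp, by simp; positivity⟩

/-- From a name of a positive real a realizer of its positivity is found by search. -/
lemma exists_pos_search :
    ∃ P : ℕ →. ℕ, Partrec P ∧ ∀ y e, real y e → 0 < y → ∃ n ∈ P e, lt 0 y n := by
  -- Approximations err by at most 1/(n+1), so passing the test 2/(n+1) < q gives 1/(n+1) < y; the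
  -- test does pass once 1/(n+1) < y/3.
  have hdec : Computable₂ fun (p : ℕ × ℕ) (q : ℕ) => decide (2 * (1 / ((p.2 : ℚ) + 1)) < rat q) :=
    RatComp.computable_lt ((RatComp.const 2).mul (.inv_succ (Computable.snd.comp .fst)))
      (.rat .snd)
  have hp : Partrec₂ fun e n : ℕ =>
      (app e n).map fun q => decide (2 * (1 / ((n : ℚ) + 1)) < rat q) :=
    Partrec.map partrec_app hdec
  refine ⟨_, Partrec.rfind hp, fun y e hy h0 => ?_⟩
  have hdom : (Nat.rfind fun n => (app e n).map
      fun q => decide (2 * (1 / ((n : ℚ) + 1)) < rat q)).Dom := by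
    refine Nat.rfind_dom'.2 ?_
    obtain ⟨n, hn⟩ := exists_nat_one_div_lt (show 0 < y / 3 by positivity)
    obtain ⟨q, hq, hle⟩ := hy n
    refine ⟨n, ?_, fun {m} _ => ?_⟩
    · rw [Part.mem_map_iff]
      refine ⟨q, hq, decide_eq_true ?_⟩
      have := (abs_le.1 hle).2
      rw [← Rat.cast_lt (K := ℝ)]
      push_cast
      linarith
    · obtain ⟨q, hq, -⟩ := hy m
      exact Part.dom_iff_mem.2 ⟨_, Part.mem_map _ hq⟩
  refine ⟨_, Part.get_mem hdom, ?_⟩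
  have hs := Nat.rfind_spec (Part.get_mem hdom)
  set n := (Nat.rfind fun n => (app e n).map
      fun q => decide (2 * (1 / ((n : ℚ) + 1)) < rat q)).get hdom
  rw [Part.mem_map_iff] at hs
  obtain ⟨q, hq, hlt⟩ := hs
  have hlt := of_decide_eq_true hlt
  obtain ⟨q', hq', hle⟩ := hy n
  obtain rfl := Part.mem_unique hq hq'
  have h1 : 2 * (1 / ((n : ℝ) + 1)) < rat q := by
    have := (Rat.cast_lt (K := ℝ)).2 hlt
    push_cast at this
    exact this
  have := (abs_le.1 hle).1
  show 1 / ((n : ℝ) + 1) < y - 0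
  linarith

/-! ### Lipschitz functions that are computable on the rationals -/

/-- The functions `F p` have the Lipschitz constant `L`, and their values at rational points can be
approximated, computably in `p`. -/
def EffLip (L : ℕ) (F : ℕ → ℝ → ℝ) : Prop :=
  (∀ p x y, |F p x - F p y| ≤ L * |x - y|) ∧
  ∃ A : ℕ × ℕ × ℕ → ℚ, RatComp A ∧
    ∀ p q n, |F p (rat q) - (A (p, q, n) : ℝ)| ≤ 1 / ((n : ℝ) + 1)

/-- The error 1/(n+1) is split in half: one half for replacing x by a rational, through the
Lipschitz bound, the other for the approximation at that rational. -/
lemma EffLip.exists_name {L : ℕ} {F : ℕ → ℝ → ℝ} (h : EffLip L F) :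
    ∃ s : ℕ → ℕ, Computable s ∧ ∀ p x e, real x e → real (F p x) (s (Nat.pair p e)) := by
  obtain ⟨hL, A, ⟨a, ha, hae⟩, hA⟩ := h
  have hM : Computable fun c : ℕ × ℕ => 2 * (L + 1) * (c.2 + 1) :=
    computable_mul (.const _) (computable_add .snd (.const 1))
  have h1 : Partrec fun c : ℕ × ℕ => app c.1.unpair.2 (2 * (L + 1) * (c.2 + 1)) :=
    partrec_app.comp (computable_unpair_snd .fst) hM
  have h2 : Computable₂ fun (c : ℕ × ℕ) (q : ℕ) => a (c.1.unpair.1, q, 2 * c.2 + 1) :=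
    ha.comp ((computable_unpair_fst (Computable.fst.comp .fst)).pair
      (Computable.snd.pair (computable_add (computable_mul (.const 2)
        (Computable.snd.comp .fst)) (.const 1))))
  obtain ⟨s, hs, hse⟩ := exists_curry (f := fun b n =>
    (app b.unpair.2 (2 * (L + 1) * (n + 1))).map fun q => a (b.unpair.1, q, 2 * n + 1))
    (Partrec.map h1 h2)
  refine ⟨s, hs, fun p x e hx n => ?_⟩
  obtain ⟨q, hq, hle⟩ := hx (2 * (L + 1) * (n + 1))
  refine ⟨a (p, q, 2 * n + 1), ?_, ?_⟩
  · rw [hse, Part.mem_map_iff]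
    exact ⟨q, by simpa using hq, by simp⟩
  · rw [hae]
    have e1 := hL p x (rat q)
    have e2 := hA p q (2 * n + 1)
    have e3 : (L : ℝ) * |x - rat q| ≤ 1 / (2 * ((n : ℝ) + 1)) := by
      push_cast at hle
      calc (L : ℝ) * |x - rat q| ≤ (L + 1) * (1 / (2 * (L + 1) * (n + 1))) := by
            refine mul_le_mul (by linarith) (hle.trans ?_) (abs_nonneg _) (by positivity)
            apply one_div_le_one_div_of_le (by positivity)
            linarith
        _ = _ := by field_simp
    push_cast at e2
    have e4 : (1 : ℝ) / (2 * n + 1 + 1) = 1 / (2 * (n + 1)) := by ring_nf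
    have e5 : (1 : ℝ) / (n + 1) = 1 / (2 * (n + 1)) + 1 / (2 * (n + 1)) := by field_simp; norm_num
    rw [e5]
    calc _ ≤ |F p x - F p (rat q)| + |F p (rat q) - (A (p, q, 2 * n + 1) : ℝ)| :=
          abs_sub_le _ _ _
      _ ≤ _ := by linarith

lemma EffLip.holds_fn {L : ℕ} {F : ℝ → ℝ} (h : EffLip L fun _ => F) (a b : ℝ) :
    Holds (fn (interval a b) real F) := by
  obtain ⟨s, hs, hF⟩ := h.exists_name
  refine Holds.forAll_total (A := interval a b) (P := fun x => real (F x))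
    (f := fun n => s (Nat.pair 0 n.unpair.1)) (hs.comp (computable_natPair (.const 0)
      (computable_unpair_fst .id))) fun x n hx => hF 0 x _ (interval_iff.1 hx).1

lemma EffLip.holds_uniformlyContinuous {L : ℕ} {F : ℝ → ℝ} (h : EffLip L fun _ => F) (X : RSet ℝ) :
    Holds (UniformlyContinuous X F) := by
  have hd : Computable fun n : ℕ => 2 * (L + 1) * (n.unpair.2 + 1) :=
    computable_mul (.const _) (computable_add (computable_unpair_snd .id) (.const 1))
  have h1 : Computable fun n : ℕ => constName (ratCode 1 0 (2 * (L + 1) * (n.unpair.2 + 1))) :=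
    computable_constName.comp (Computable.ratCode (.const 1) (.const 0) hd)
  have h2 : Computable fun n : ℕ =>
      constName (constName (constName (2 * n.unpair.2 + 1))) :=
    computable_constName.comp (computable_constName.comp (computable_constName.comp
      (computable_add (computable_mul (.const 2) (computable_unpair_snd .id)) (.const 1))))
  -- With 1/(k+1) < ε and N = 2(L+1)(k+1), δ is 1/(N+1), and N+1 realizes its positivity. The slack
  -- 1/(2(k+1)) does not depend on the points, so constant programs suffice.
  refine Holds.forAll_total (computable_natPair (computable_natPair h1
    (computable_add hd (.const 1))) h2) fun ε n hε => ?_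
  rw [pos_iff] at hε
  set k := n.unpair.2
  set N := 2 * (L + 1) * (k + 1)
  refine exist_pair (rat (ratCode 1 0 N) : ℝ) ?_ (forAll_constName fun x _ _ =>
    forAll_constName fun y _ _ => impl_constName fun m hm => ?_)
  · rw [pos_iff]
    refine ⟨by simpa only [Nat.unpair_pair] using real_constName _, ?_⟩
    simp only [Nat.unpair_pair, rat_ratCode]
    push_cast
    rw [sub_zero]
    apply one_div_lt_one_div_of_lt (by positivity)
    linarith
  · have h3 := lt_of_lt hm
    rw [rat_ratCode] at h3
    have h4 := h.1 0 x y
    have h5 : (L : ℝ) * |x - y| ≤ 1 / (2 * ((k : ℝ) + 1)) := by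
      calc (L : ℝ) * |x - y| ≤ (L + 1) * (1 / (2 * (L + 1) * (k + 1))) := by
            refine mul_le_mul (by linarith) (h3.le.trans ?_) (abs_nonneg _) (by positivity)
            push_cast [N]
            rw [sub_zero]
            apply one_div_le_one_div_of_le (by positivity)
            linarith
        _ = _ := by field_simp
    have e5 : (1 : ℝ) / (k + 1) = 1 / (2 * (k + 1)) + 1 / (2 * (k + 1)) := by field_simp; norm_num
    show (1 : ℝ) / (((2 * k + 1 : ℕ) : ℝ) + 1) < ε - |F x - F y|
    have e4 : (1 : ℝ) / (((2 * k + 1 : ℕ) : ℝ) + 1) = 1 / (2 * (k + 1)) := by push_cast; ring_nf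
    rw [e4]
    linarith [hε.2]

/-! ### A Lipschitz function whose zeros are not computable -/

/-- For `i = ⟨e, k⟩`, the output of the `e`-th program on `2 ^ (e + 5) - 1` after `k` steps. -/
def output (i : ℕ) : Option ℕ :=
  Nat.Partrec.Code.evaln i.unpair.2 (Denumerable.ofNat Nat.Partrec.Code i.unpair.1)
    (2 ^ (i.unpair.1 + 5) - 1)

lemma computable_output : Computable output :=
  Nat.Partrec.Code.primrec_evaln.to_comp.comp
    (((computable_unpair_snd .id).pair ((Computable.ofNat _).comp (computable_unpair_fst .id))).pair
      (computable_sub (computable_two_pow (computable_add (computable_unpair_fst .id) (.const 5)))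
        (.const 1)))

/-- The height over `x` of a tent whose base covers all reals named by the program `i.unpair.1`,
provided that its output is found within `i.unpair.2` steps. -/
noncomputable def tent (i : ℕ) (x : ℝ) : ℝ :=
  (output i).elim 0 fun m => max 0 (2 * (1 / 2 ^ (i.unpair.1 + 5)) - |x - rat m|)

def tentRat (i : ℕ) (x : ℚ) : ℚ :=
  (output i).elim 0 fun m => max 0 (2 * (1 / 2 ^ (i.unpair.1 + 5)) - |x - rat m|)

lemma cast_tentRat (i : ℕ) (x : ℚ) : (tentRat i x : ℝ) = tent i x := by
  unfold tentRat tent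
  cases output i <;> simp

lemma tent_nonneg (i : ℕ) (x : ℝ) : 0 ≤ tent i x := by
  unfold tent
  cases output i <;> simp

lemma tent_le_one (i : ℕ) (x : ℝ) : tent i x ≤ 1 := by
  unfold tent
  cases output i with
  | none => simp
  | some m =>
    refine max_le zero_le_one ?_
    have h : (1 : ℝ) / 2 ^ (i.unpair.1 + 5) ≤ 1 / 2 ^ 1 :=
      one_div_le_one_div_of_le (by norm_num) (pow_le_pow_right₀ (by norm_num) (by omega))
    have := abs_nonneg (x - rat m)
    linarith

lemma abs_tent_sub_le (i : ℕ) (x y : ℝ) : |tent i x - tent i y| ≤ |x - y| := by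
  unfold tent
  cases output i with
  | none => simp
  | some m =>
    refine (abs_max_sub_max_le_max _ _ _ _).trans (max_le (by simp) ?_)
    rw [sub_sub_sub_cancel_left, abs_sub_comm x y]
    refine (abs_abs_sub_abs_le_abs_sub _ _).trans_eq ?_
    rw [sub_sub_sub_cancel_right]

/-- The sum of the tents, with geometric weights. -/
noncomputable def tents (x : ℝ) : ℝ := ∑' i, 1 / 2 / 2 ^ i * tent i x

lemma summable_tents (x : ℝ) : Summable fun i => 1 / 2 / 2 ^ i * tent i x :=
  Summable.of_nonneg_of_le (fun i => mul_nonneg (by positivity) (tent_nonneg i x))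
    (fun i => mul_le_of_le_one_right (by positivity) (tent_le_one i x))
    (hasSum_geometric_two' 1).summable

lemma tents_nonneg (x : ℝ) : 0 ≤ tents x :=
  tsum_nonneg fun i => mul_nonneg (by positivity) (tent_nonneg i x)

lemma tents_sub_sum_le (x : ℝ) (n : ℕ) :
    |tents x - ∑ i ∈ Finset.range n, 1 / 2 / 2 ^ i * tent i x| ≤ 1 / 2 ^ n := by
  rw [tents, ← (summable_tents x).sum_add_tsum_nat_add n, add_sub_cancel_left]
  rw [← Real.norm_eq_abs]
  refine tsum_of_norm_bounded (hasSum_geometric_two' (1 / 2 ^ n)) fun i => ?_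
  rw [Real.norm_of_nonneg (mul_nonneg (by positivity) (tent_nonneg _ x))]
  refine (mul_le_of_le_one_right (by positivity) (tent_le_one _ x)).trans_eq ?_
  rw [pow_add]
  field_simp

lemma tents_le_one (x : ℝ) : tents x ≤ 1 := by
  have := (abs_le.1 (tents_sub_sum_le x 0)).2
  simpa using this

lemma abs_tents_sub_le (x y : ℝ) : |tents x - tents y| ≤ |x - y| := by
  rw [tents, tents, ← (summable_tents x).tsum_sub (summable_tents y)]
  rw [← Real.norm_eq_abs]
  refine tsum_of_norm_bounded (hasSum_geometric_two' |x - y|) fun i => ?_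
  rw [← mul_sub, norm_mul, Real.norm_of_nonneg (by positivity), Real.norm_eq_abs]
  refine (mul_le_mul_of_nonneg_left (abs_tent_sub_le i x y) (by positivity)).trans_eq ?_
  ring

/-- Once k is large enough for the program to halt, the tent of index ⟨e, k⟩ has height at least
2^-(e+5) at x. The name is essential. -/
lemma tents_pos {x : ℝ} {e : ℕ} (hx : real x e) : 0 < tents x := by
  obtain ⟨m, hm, hle⟩ := hx (2 ^ (e + 5) - 1)
  obtain ⟨k, hk⟩ := Nat.Partrec.Code.evaln_complete.1 hm
  have ho : output (Nat.pair e k) = some m := by simpa [output] using hk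
  have h2 : (((2 ^ (e + 5) - 1 : ℕ) : ℝ) + 1) = 2 ^ (e + 5) := by
    rw [Nat.cast_sub Nat.one_le_two_pow]
    simp
  rw [h2] at hle
  have h3 : (0 : ℝ) < 1 / 2 ^ (e + 5) := by positivity
  refine (summable_tents x).tsum_pos (fun i => mul_nonneg (by positivity) (tent_nonneg i x))
    (Nat.pair e k) (mul_pos (by positivity) ?_)
  simp only [tent, ho, Option.elim_some, Nat.unpair_pair]
  exact lt_max_of_lt_right (by linarith)

-- All tents of one program share the base `B e`, whatever the step count, so its length 4/2^(e+5)
-- counts once per program. These lengths sum to 1/4, less than the length 1/2 of the interval.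
open MeasureTheory in
lemma exists_tents_eq_zero : ∃ x : ℝ, 0 ≤ x ∧ x ≤ 1 / 2 ∧ tents x = 0 := by
  classical
  let B : ℕ → Set ℝ := fun e => {x | ∃ m ∈ app e (2 ^ (e + 5) - 1),
    |x - rat m| < 2 * (1 / 2 ^ (e + 5))}
  have hB : ∀ e, volume (B e) ≤ ENNReal.ofReal (1 / 4 / 2 / 2 ^ e) := by
    intro e
    by_cases h : (app e (2 ^ (e + 5) - 1)).Dom
    · obtain ⟨m, hm⟩ := Part.dom_iff_mem.1 h
      have hsub : B e ⊆ Metric.ball (rat m : ℝ) (2 * (1 / 2 ^ (e + 5))) := by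
        rintro x ⟨m', hm', hx⟩
        obtain rfl := Part.mem_unique hm hm'
        exact hx
      refine (measure_mono hsub).trans_eq ?_
      rw [Real.volume_ball]
      congr 1
      rw [pow_add]
      field_simp
      norm_num
    · have : B e = ∅ := by
        refine Set.eq_empty_of_forall_notMem ?_
        rintro x ⟨m, hm, -⟩
        exact h (Part.dom_iff_mem.2 ⟨m, hm⟩)
      simp [this]
  have hU : volume (⋃ e, B e) < volume (Set.Icc (0 : ℝ) (1 / 2)) := by
    refine ((measure_iUnion_le B).trans (ENNReal.tsum_le_tsum hB)).trans_lt ?_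
    rw [← ENNReal.ofReal_tsum_of_nonneg (fun e => by positivity)
      (hasSum_geometric_two' (1 / 4 : ℝ)).summable, tsum_geometric_two', Real.volume_Icc,
      ENNReal.ofReal_lt_ofReal_iff (by norm_num)]
    norm_num
  obtain ⟨x, hx, hxB⟩ : ∃ x ∈ Set.Icc (0 : ℝ) (1 / 2), x ∉ ⋃ e, B e := by
    by_contra! h
    exact hU.not_ge (measure_mono h)
  refine ⟨x, hx.1, hx.2, ?_⟩
  have h0 : ∀ i, tent i x = 0 := by
    intro i
    unfold tent
    cases ho : output i with
    | none => rfl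
    | some m =>
      refine max_eq_left (sub_nonpos.2 ?_)
      by_contra! hlt
      exact hxB (Set.mem_iUnion.2 ⟨i.unpair.1, m, Nat.Partrec.Code.evaln_sound ho, hlt⟩)
  simp [tents, h0]

/-! ### The extension to a function with zero at 1 -/

/-- The sum of the tents on `[0, 1 / 2]`, continued linearly to the value `0` at `1`. -/
noncomputable def singularMap (x : ℝ) : ℝ := tents (min x (1 / 2)) * max 0 (min 1 (2 - 2 * x))

lemma singularMap_nonneg (x : ℝ) : 0 ≤ singularMap x :=
  mul_nonneg (tents_nonneg _) (le_max_left _ _)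

lemma singularMap_of_le {x : ℝ} (h : x ≤ 1 / 2) : singularMap x = tents x := by
  rw [singularMap, min_eq_left h, min_eq_left (by linarith), max_eq_right zero_le_one, mul_one]

lemma singularMap_of_ge {x : ℝ} (h : 1 / 2 ≤ x) (h1 : x ≤ 1) :
    singularMap x = tents (1 / 2) * (2 - 2 * x) := by
  rw [singularMap, min_eq_right h, min_eq_right (by linarith), max_eq_right (by linarith)]

lemma singularMap_one : singularMap 1 = 0 := by
  rw [singularMap_of_ge (by norm_num) le_rfl]; ring

lemma real_half : real (1 / 2) (constName (ratCode 1 0 1)) := by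
  have := real_constName (ratCode 1 0 1)
  rw [rat_ratCode] at this
  convert this using 1
  norm_num

lemma real_one : real 1 (constName (ratCode 1 0 0)) := by
  have := real_constName (ratCode 1 0 0)
  rw [rat_ratCode] at this
  convert this using 1
  norm_num

lemma singularMap_pos {x : ℝ} {e : ℕ} (hx : real x e) (h1 : x < 1) : 0 < singularMap x := by
  rcases le_total x (1 / 2) with h | h
  · rw [singularMap_of_le h]
    exact tents_pos hx
  · rw [singularMap_of_ge h h1.le]
    exact mul_pos (tents_pos real_half) (by linarith)

/-- Both factors are bounded by 1 and have Lipschitz constants 1 and 2; the product has 1 + 2. -/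
lemma abs_singularMap_sub_le (x y : ℝ) : |singularMap x - singularMap y| ≤ 3 * |x - y| := by
  have h1 : |tents (min x (1 / 2)) - tents (min y (1 / 2))| ≤ |x - y| :=
    (abs_tents_sub_le _ _).trans ((abs_min_sub_min_le_max _ _ _ _).trans (by simp))
  have h2 : |max 0 (min 1 (2 - 2 * x)) - max 0 (min 1 (2 - 2 * y))| ≤ 2 * |x - y| := by
    refine (abs_max_sub_max_le_max _ _ _ _).trans (max_le (by simp) ?_)
    refine (abs_min_sub_min_le_max _ _ _ _).trans (max_le (by simp) ?_)
    rw [sub_sub_sub_cancel_left, ← mul_sub, abs_mul, abs_sub_comm y x, abs_two]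
  have h3 : |max 0 (min 1 (2 - 2 * x))| ≤ 1 := by
    rw [abs_of_nonneg (le_max_left _ _)]
    exact max_le zero_le_one (min_le_left _ _)
  have h4 : |tents (min y (1 / 2))| ≤ 1 := by
    rw [abs_of_nonneg (tents_nonneg _)]
    exact tents_le_one _
  have : singularMap x - singularMap y =
      (tents (min x (1 / 2)) - tents (min y (1 / 2))) * max 0 (min 1 (2 - 2 * x)) +
      tents (min y (1 / 2)) * (max 0 (min 1 (2 - 2 * x)) - max 0 (min 1 (2 - 2 * y))) := by
    rw [singularMap, singularMap]; ring
  rw [this]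
  refine (abs_add_le _ _).trans ?_
  rw [abs_mul, abs_mul]
  have h5 := mul_le_mul h1 h3 (abs_nonneg _) (abs_nonneg _)
  have h6 := mul_le_mul h4 h2 (abs_nonneg _) zero_le_one
  linarith

/-! ### Computable approximations and small values -/

lemma RatComp.inv_two_pow {α : Type} [Primcodable α] {f : α → ℕ} (hf : Computable f) :
    RatComp fun a => (1 : ℚ) / 2 ^ f a :=
  (RatComp.inv_succ (computable_sub (computable_two_pow hf) (.const 1))).of_eq fun a => by
    rw [Nat.cast_sub Nat.one_le_two_pow]
    simp

lemma ratComp_tentRat {α : Type} [Primcodable α] {i : α → ℕ} {φ : α → ℚ} (hi : Computable i)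
    (hφ : RatComp φ) : RatComp fun a => tentRat (i a) (φ a) := by
  have h : RatComp fun p : α × ℕ =>
      max 0 (2 * (1 / 2 ^ ((i p.1).unpair.1 + 5)) - |φ p.1 - rat p.2|) :=
    (RatComp.const 0).max (((RatComp.const 2).mul (.inv_two_pow (computable_add
      (computable_unpair_fst (hi.comp .fst)) (.const 5)))).sub
      ((hφ.comp .fst).sub (.rat .snd)).abs)
  exact RatComp.option (computable_output.comp hi) h (.const 0)

/-- The first n tents suffice: the tail is at most 2^-n ≤ 1/(n+1), and the ramp factor at most 1. -/
lemma effLip_singularMap : EffLip 3 fun _ => singularMap := by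
  refine ⟨fun _ => abs_singularMap_sub_le, fun c => (∑ i ∈ Finset.range c.2.2,
    1 / 2 * (1 / 2 ^ i) * tentRat i (min (rat c.2.1) (1 / 2))) *
    max 0 (min 1 (2 - 2 * rat c.2.1)), ?_, fun _ q n => ?_⟩
  · have hq : Computable fun c : ℕ × ℕ × ℕ => c.2.1 := Computable.fst.comp .snd
    have hn : Computable fun c : ℕ × ℕ × ℕ => c.2.2 := Computable.snd.comp .snd
    have h : RatComp fun c : (ℕ × ℕ × ℕ) × ℕ =>
        1 / 2 * (1 / 2 ^ c.2) * tentRat c.2 (min (rat c.1.2.1) (1 / 2)) :=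
      ((RatComp.const _).mul (.inv_two_pow .snd)).mul
        (ratComp_tentRat .snd ((RatComp.rat (hq.comp .fst)).min (.const _)))
    exact (h.sum hn).mul ((RatComp.const 0).max ((RatComp.const 1).min
      ((RatComp.const 2).sub ((RatComp.const 2).mul (.rat hq)))))
  · push_cast
    simp only [cast_tentRat]
    push_cast
    rw [singularMap, ← sub_mul, abs_mul]
    have h1 := tents_sub_sum_le (min (rat q : ℝ) (1 / 2)) n
    have h3 : |max 0 (min 1 (2 - 2 * (rat q : ℝ)))| ≤ 1 := by
      rw [abs_of_nonneg (le_max_left _ _)]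
      exact max_le zero_le_one (min_le_left _ _)
    have h2 : (1 : ℝ) / 2 ^ n ≤ 1 / (n + 1) := by
      apply one_div_le_one_div_of_le (by positivity)
      exact_mod_cast Nat.lt_two_pow_self (n := n)
    refine (mul_le_of_le_one_right (abs_nonneg _) h3).trans (le_trans (le_of_eq ?_) (h1.trans h2))
    simp only [div_eq_mul_inv, one_mul]

lemma exists_rat_singularMap_lt {ε : ℝ} (hε : 0 < ε) :
    ∃ q : ℚ, 0 ≤ q ∧ q ≤ 1 / 2 ∧ singularMap q < ε := by
  obtain ⟨x, h0, h1, hx⟩ := exists_tents_eq_zero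
  obtain ⟨q, hq, hq'⟩ : ∃ q : ℚ, |x - q| < ε / 3 ∧ 0 ≤ q ∧ q ≤ 1 / 2 := by
    -- The zero may be an endpoint, so it is approached from the side that stays inside [0, 1/2].
    rcases lt_or_ge x (1 / 4) with h | h
    · obtain ⟨q, hq1, hq2⟩ := exists_rat_btwn (show x < min (x + ε / 3) (1 / 2) from
        lt_min (by linarith) (by linarith))
      have a := hq2.trans_le (min_le_left _ _)
      have b := hq2.trans_le (min_le_right _ _)
      refine ⟨q, abs_lt.2 ⟨by linarith, by linarith⟩, ?_, ?_⟩
      · have : (0 : ℝ) ≤ q := by linarith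
        exact_mod_cast this
      · have : (q : ℝ) ≤ ((1 / 2 : ℚ) : ℝ) := by push_cast; linarith
        exact_mod_cast this
    · obtain ⟨q, hq1, hq2⟩ := exists_rat_btwn (show max (x - ε / 3) 0 < x from
        max_lt (by linarith) (by linarith))
      have a := (le_max_left _ _).trans_lt hq1
      have b := (le_max_right _ _).trans_lt hq1
      refine ⟨q, abs_lt.2 ⟨by linarith, by linarith⟩, ?_, ?_⟩
      · exact_mod_cast b.le
      · have : (q : ℝ) ≤ ((1 / 2 : ℚ) : ℝ) := by push_cast; linarith
        exact_mod_cast this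
  refine ⟨q, hq'.1, hq'.2, ?_⟩
  have h := abs_singularMap_sub_le x q
  rw [singularMap_of_le h1, hx] at h
  have := (abs_le.1 h).1
  linarith

/-! ### Realizers of the statements about the function -/

/-- The name of α serves as its own program e; the number of steps on each input is found by search,
which ends because that program is total. -/
lemma holds_CMT : Holds CMT := by
  have hev : Computable₂ fun (c : ℕ × ℕ) (k : ℕ) => (Nat.Partrec.Code.evaln k
      (Denumerable.ofNat Nat.Partrec.Code c.1) c.2).isSome :=
    Primrec.option_isSome.to_comp.comp (Nat.Partrec.Code.primrec_evaln.to_comp.comp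
      ((Computable.snd.pair ((Computable.ofNat _).comp (Computable.fst.comp .fst))).pair
        (Computable.snd.comp .fst)))
  have hr : Partrec₂ fun e n : ℕ => (Nat.rfind fun k => Part.some (Nat.Partrec.Code.evaln k
      (Denumerable.ofNat Nat.Partrec.Code e) n).isSome).map fun k => Nat.pair k 0 :=
    Partrec.map (Partrec.rfind hev.partrec₂) (computable_natPair .snd (.const 0))
  obtain ⟨s, hs, hse⟩ := exists_curry hr
  refine Holds.forAll_total (computable_natPair .id hs) fun α e hα => exist_pair e rfl ?_
  rintro _ n rfl
  obtain ⟨_, hm, rfl⟩ := hα n n rfl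
  obtain ⟨k, hk⟩ := Nat.Partrec.Code.evaln_complete.1 hm
  obtain ⟨k', hk', -⟩ := Nat.rfind_min' (p := fun k => (Nat.Partrec.Code.evaln k
    (Denumerable.ofNat Nat.Partrec.Code e) n).isSome) (Option.isSome_of_mem hk)
  refine ⟨Nat.pair k' 0, ?_, exist_pair k' rfl ?_⟩
  · rw [hse]
    exact Part.mem_map (fun k => Nat.pair k 0) hk'
  · obtain ⟨m, hm'⟩ := Option.isSome_iff_exists.1 (Part.mem_some_iff.1 (Nat.rfind_spec hk')).symm
    have := Part.mem_unique hm (Nat.Partrec.Code.evaln_sound hm')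
    rw [atom, this]
    exact hm'

lemma holds_singularMap_pos :
    Holds (forAll (interval 0 (1 / 2)) fun x => lt 0 (singularMap x)) := by
  obtain ⟨s, hs, hF⟩ := effLip_singularMap.exists_name
  obtain ⟨P, hP, hP'⟩ := exists_pos_search
  refine Holds.forAll (f := fun n => P (s (Nat.pair 0 n.unpair.1)))
    (hP.comp (hs.comp (computable_natPair (.const 0) (computable_unpair_fst .id))))
    fun x n hx => ?_
  rw [interval_iff] at hx
  exact hP' _ _ (hF 0 x _ hx.1) (singularMap_pos hx.1 (by linarith [hx.2.2]))

/-- Rational points with small values are found by search. -/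
lemma exists_search_singularMap_lt :
    ∃ t : ℕ → ℕ, Computable t ∧ ∀ n, 0 ≤ rat (t n) ∧ rat (t n) ≤ 1 / 2 ∧
      singularMap (rat (t n)) < 3 / (4 * ((n : ℝ) + 1)) := by
  obtain ⟨-, A, hA, hle⟩ := effLip_singularMap
  have hA' : RatComp fun c : ℕ × ℕ => A (0, c.2, 4 * c.1 + 3) :=
    hA.comp ((Computable.const 0).pair (Computable.snd.pair
      (computable_add (computable_mul (.const 4) .fst) (.const 3))))
  have hb : RatComp fun c : ℕ × ℕ => 1 / 2 * (1 / ((c.1 : ℚ) + 1)) :=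
    (RatComp.const _).mul (.inv_succ .fst)
  have hq : RatComp fun c : ℕ × ℕ => rat c.2 := .rat .snd
  -- In units of 1/(4(n+1)) the approximation errs by at most 1 and is tested against 2. A point
  -- with value below 1 passes, and passing bounds the value by 3.
  have hdec : ComputablePred fun c : ℕ × ℕ => (¬ rat c.2 < 0 ∧ ¬ 1 / 2 < rat c.2) ∧
      A (0, c.2, 4 * c.1 + 3) < 1 / 2 * (1 / ((c.1 : ℚ) + 1)) := by
    refine Computable.computablePred ?_
    have h1 := hq.computable_lt (.const 0)
    have h2 := (RatComp.const (1 / 2)).computable_lt hq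
    have h3 := hA'.computable_lt hb
    refine (Primrec.and.to_comp.comp (Primrec.and.to_comp.comp (Primrec.not.to_comp.comp h1)
      (Primrec.not.to_comp.comp h2)) h3).of_eq fun c => ?_
    simp only [Bool.decide_and, decide_not]
  have e4 : ∀ n : ℕ, (1 : ℝ) / (((4 * n + 3 : ℕ) : ℝ) + 1) = 1 / (4 * ((n : ℝ) + 1)) := by
    intro n
    push_cast
    ring_nf
  have hex : ∀ n : ℕ, ∃ q, (¬ rat q < 0 ∧ ¬ 1 / 2 < rat q) ∧
      A (0, q, 4 * n + 3) < 1 / 2 * (1 / ((n : ℚ) + 1)) := by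
    intro n
    obtain ⟨q, h0, h1, h2⟩ :=
      exists_rat_singularMap_lt (show 0 < 1 / (4 * ((n : ℝ) + 1)) by positivity)
    obtain ⟨c, rfl⟩ := rat_surjective q
    refine ⟨c, ⟨not_lt.2 h0, not_lt.2 h1⟩, ?_⟩
    have h3 := (abs_le.1 (hle 0 c (4 * n + 3))).1
    rw [e4] at h3
    have h4 : (1 : ℝ) / 2 * (1 / (n + 1)) = 1 / (4 * (n + 1)) + 1 / (4 * (n + 1)) := by
      field_simp; norm_num
    rw [← Rat.cast_lt (K := ℝ)]
    push_cast
    linarith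
  classical
  refine ⟨_, Computable.find (P := fun n q => (¬ rat q < 0 ∧ ¬ 1 / 2 < rat q) ∧
      A (0, q, 4 * n + 3) < 1 / 2 * (1 / ((n : ℚ) + 1))) hdec hex, fun n => ?_⟩
  obtain ⟨⟨h0, h1⟩, h2⟩ := Nat.find_spec (hex n)
  refine ⟨not_lt.1 h0, not_lt.1 h1, ?_⟩
  set q := Nat.find (hex n)
  have h3 := (abs_le.1 (hle 0 q (4 * n + 3))).2
  rw [e4] at h3
  have h2 := (Rat.cast_lt (K := ℝ)).2 h2
  push_cast at h2
  have h4 : (3 : ℝ) / (4 * (n + 1)) = 1 / 2 * (1 / (n + 1)) + 1 / (4 * (n + 1)) := by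
    field_simp; norm_num
  linarith

lemma holds_isInfimum_singularMap : Holds (IsInfimum (interval 0 (1 / 2)) singularMap 0) := by
  refine Holds.conj ⟨constName 0, forAll_constName fun x _ _ => le_iff.2 (singularMap_nonneg x)⟩ ?_
  obtain ⟨t, ht, h⟩ := exists_search_singularMap_lt
  have ht' : Computable fun n : ℕ => t n.unpair.2 := ht.comp (computable_unpair_snd .id)
  -- With 1/(k+1) < ε and a value below 3/(4(k+1)), the remaining slack exceeds 1/(4(k+1)), realized
  -- by 4k+3.
  refine Holds.forAll_total (computable_natPair
    (computable_natPair (computable_constName.comp ht') (.const 0))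
    (computable_add (computable_mul (.const 4) (computable_unpair_snd .id)) (.const 3)))
    fun ε n hε => ?_
  rw [pos_iff] at hε
  obtain ⟨h0, h1, h2⟩ := h n.unpair.2
  refine exist_pair (rat (t n.unpair.2) : ℝ) ?_ ?_
  · rw [interval_iff]
    refine ⟨by simpa only [Nat.unpair_pair] using real_constName _, by exact_mod_cast h0, ?_⟩
    have h1 := (Rat.cast_le (K := ℝ)).2 h1
    push_cast at h1
    exact h1
  · show (1 : ℝ) / (((4 * n.unpair.2 + 3 : ℕ) : ℝ) + 1) < 0 + ε - _
    have e1 : (1 : ℝ) / (((4 * n.unpair.2 + 3 : ℕ) : ℝ) + 1) = 1 / (4 * (n.unpair.2 + 1)) := by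
      push_cast
      ring_nf
    have e2 : (1 : ℝ) / (n.unpair.2 + 1) =
        1 / (4 * (n.unpair.2 + 1)) + 3 / (4 * (n.unpair.2 + 1)) := by
      field_simp; norm_num
    rw [e1]
    linarith [hε.2]

/-! ### The linear piece, the zero set and its locatedness -/

lemma singularMap_eq_linear {x : ℝ} (h : 1 / 2 ≤ x) (h1 : x ≤ 1) :
    singularMap x = (2 - 2 * x) * singularMap (1 / 2) + (2 * x - 1) * singularMap 1 := by
  rw [singularMap_of_ge h h1, singularMap_one, singularMap_of_le le_rfl]
  ring

/-- Classical zeros in [0, 1/2] do not count: an element of the zero set carries a name, which makes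
the value positive below 1. -/
lemma eq_one_of_zeros {x : ℝ} {e : ℕ} (h : zeros (interval 0 1) singularMap x e) : x = 1 := by
  rw [zeros_iff] at h
  by_contra hne
  exact (singularMap_pos h.1 (lt_of_le_of_ne h.2.1.2 hne)).ne' h.2.2

lemma zeros_one {e : ℕ} (he : real 1 e) :
    zeros (interval 0 1) singularMap 1 (Nat.pair (Nat.pair e 0) 0) := by
  rw [zeros_iff]
  refine ⟨by simpa only [Nat.unpair_pair] using he, ⟨zero_le_one, le_rfl⟩, singularMap_one⟩

/-- A name of `1` as a zero of `singularMap`. -/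
def zeroName : ℕ := Nat.pair (Nat.pair (constName (ratCode 1 0 0)) 0) 0

lemma zeros_zeroName : zeros (interval 0 1) singularMap 1 zeroName := zeros_one real_one

lemma holds_zeros_iff :
    Holds (forAll real fun x => iff (zeros (interval 0 1) singularMap x) (eq x 1)) := by
  refine Holds.forAll_total (f := fun n => Nat.pair (constName 0)
    (constName (Nat.pair (Nat.pair n 0) 0))) (computable_natPair (.const _)
      (computable_constName.comp (computable_natPair (computable_natPair .id (.const 0))
        (.const 0)))) fun x n hx => ?_
  refine conj_pair (impl_constName fun m hm => eq_iff.2 (eq_one_of_zeros hm))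
    (impl_constName fun m hm => ?_)
  obtain rfl := eq_iff.1 hm
  exact zeros_one hx

lemma effLip_abs_sub_one : EffLip 1 fun _ x => |x - 1| := by
  refine ⟨fun _ x y => ?_, fun c => |rat c.2.1 - 1|,
    ((RatComp.rat (Computable.fst.comp .snd)).sub (.const 1)).abs, fun _ q n => ?_⟩
  · refine (abs_abs_sub_abs_le_abs_sub _ _).trans_eq ?_
    simp
  · push_cast
    simp
    positivity

/-- The distance is |x - 1|, attained at the zero 1, so the realizer of 0 < ε also serves for the
strict inequality. -/
lemma holds_located : Holds (Located (interval 0 1) (zeros (interval 0 1) singularMap)) := by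
  obtain ⟨s, hs, hF⟩ := effLip_abs_sub_one.exists_name
  obtain ⟨e, he⟩ := exists_name (f := fun n => Part.some (Nat.pair zeroName n.unpair.2))
    (computable_natPair (.const _) (computable_unpair_snd .id)).partrec
  refine Holds.forAll_total (f := fun n => Nat.pair (s (Nat.pair 0 n.unpair.1))
    (Nat.pair (constName 0) e)) (computable_natPair
      (hs.comp (computable_natPair (.const 0) (computable_unpair_fst .id))) (.const _))
    fun x n hx => ?_
  rw [interval_iff] at hx
  refine exist_pair |x - 1| (hF 0 x _ hx.1) (conj_pair (forAll_constName fun y m hy => ?_)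
    fun ε m hε => ⟨_, by rw [he]; exact Part.mem_some _, exist_pair 1 zeros_zeroName ?_⟩)
  · rw [eq_one_of_zeros hy]
    exact le_iff.2 le_rfl
  · rw [pos_iff] at hε
    show 1 / ((m.unpair.2 : ℝ) + 1) < |x - 1| + ε - |x - 1|
    linarith [hε.2]

/-! ### Pointwise but not uniform Z-stability -/

/-- A modulus of Z-stability of `singularMap`, for the precision `1 / (2 * (p + 1))`. -/
noncomputable def stabilityModulus (p : ℕ) (x : ℝ) : ℝ :=
  singularMap x + max 0 (1 / 2 * (1 / ((p : ℝ) + 1)) - |x - 1|)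

lemma effLip_stabilityModulus : EffLip 4 stabilityModulus := by
  obtain ⟨hL, A, hA, hle⟩ := effLip_singularMap
  refine ⟨fun p x y => ?_, fun c => A (0, c.2.1, c.2.2) +
    max 0 (1 / 2 * (1 / ((c.1 : ℚ) + 1)) - |rat c.2.1 - 1|), ?_, fun p q n => ?_⟩
  · have h1 := hL 0 x y
    have h2 : |max 0 (1 / 2 * (1 / ((p : ℝ) + 1)) - |x - 1|) -
        max 0 (1 / 2 * (1 / ((p : ℝ) + 1)) - |y - 1|)| ≤ |x - y| := by
      refine (abs_max_sub_max_le_max _ _ _ _).trans (max_le (by simp) ?_)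
      rw [sub_sub_sub_cancel_left, abs_sub_comm x y]
      refine (abs_abs_sub_abs_le_abs_sub _ _).trans_eq ?_
      rw [sub_sub_sub_cancel_right]
    rw [stabilityModulus, stabilityModulus, add_sub_add_comm]
    refine (abs_add_le _ _).trans ?_
    push_cast at h1 ⊢
    linarith
  · have hq : Computable fun c : ℕ × ℕ × ℕ => c.2.1 := Computable.fst.comp .snd
    exact (hA.comp ((Computable.const 0).pair .snd)).add ((RatComp.const 0).max
      (((RatComp.const _).mul (.inv_succ .fst)).sub ((RatComp.rat hq).sub (.const 1)).abs))
  · have h := hle 0 q n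
    push_cast
    rw [stabilityModulus, add_sub_add_right_eq_sub]
    exact h

/-- The bump is positive at 1 and `singularMap` at named points below 1. The case distinction is
classical; a realizer of positivity comes later from search. -/
lemma stabilityModulus_pos {p : ℕ} {x : ℝ} {e : ℕ} (hx : real x e) (h1 : x ≤ 1) :
    0 < stabilityModulus p x := by
  rcases h1.eq_or_lt with rfl | h
  · refine add_pos_of_nonneg_of_pos (singularMap_nonneg _) (lt_max_of_lt_right ?_)
    rw [sub_self, abs_zero, sub_zero]
    positivity
  · exact add_pos_of_pos_of_nonneg (singularMap_pos hx h) (le_max_left _ _)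

lemma abs_sub_one_lt_of_lt_stabilityModulus {p : ℕ} {x : ℝ}
    (h : |singularMap x| < stabilityModulus p x) : |x - 1| < 1 / 2 * (1 / ((p : ℝ) + 1)) := by
  rw [abs_of_nonneg (singularMap_nonneg x), stabilityModulus, lt_add_iff_pos_right, lt_max_iff] at h
  linarith [h.resolve_left (lt_irrefl 0)]

lemma holds_zStable : Holds (ZStable (interval 0 1) singularMap) := by
  obtain ⟨s, hs, hF⟩ := effLip_stabilityModulus.exists_name
  obtain ⟨P, hP, hP'⟩ := exists_pos_search
  -- The program naming δ: p is read off the realizer of 0 < ε, and the name of x off its membership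
  -- in [0, 1].
  have h1 : Computable fun c : ℕ × ℕ => s (Nat.pair c.2.unpair.2 c.1.unpair.1) :=
    hs.comp (computable_natPair (computable_unpair_snd .snd) (computable_unpair_fst .fst))
  have h2 : Computable₂ fun (c : ℕ × ℕ) (r : ℕ) =>
      Nat.pair (Nat.pair (s (Nat.pair c.2.unpair.2 c.1.unpair.1)) r)
        (constName (Nat.pair zeroName (2 * c.2.unpair.2 + 1))) :=
    computable_natPair (computable_natPair (h1.comp .fst) .snd)
      (computable_constName.comp (computable_natPair (.const _) (computable_add
        (computable_mul (.const 2) (computable_unpair_snd (Computable.snd.comp .fst)))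
        (.const 1))))
  obtain ⟨t, ht, hte⟩ := exists_curry (f := fun n k =>
    (P (s (Nat.pair k.unpair.2 n.unpair.1))).map fun r =>
      Nat.pair (Nat.pair (s (Nat.pair k.unpair.2 n.unpair.1)) r)
        (constName (Nat.pair zeroName (2 * k.unpair.2 + 1)))) (Partrec.map (hP.comp h1) h2)
  refine Holds.forAll_total ht fun x n hx ε k hε => ?_
  rw [interval_iff] at hx
  rw [pos_iff] at hε
  have hδ := hF k.unpair.2 x _ hx.1
  have hpos : 0 < stabilityModulus k.unpair.2 x := stabilityModulus_pos hx.1 hx.2.2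
  obtain ⟨r, hr, hlt⟩ := hP' _ _ hδ hpos
  refine ⟨_, by rw [hte]; exact Part.mem_map _ hr, exist_pair (stabilityModulus k.unpair.2 x)
    (conj_pair hδ hlt) (impl_constName fun m hm => exist_pair 1 zeros_zeroName ?_)⟩
  have h3 := abs_sub_one_lt_of_lt_stabilityModulus (lt_of_lt hm)
  show (1 : ℝ) / (((2 * k.unpair.2 + 1 : ℕ) : ℝ) + 1) < ε - |x - 1|
  have e4 : (1 : ℝ) / (((2 * k.unpair.2 + 1 : ℕ) : ℝ) + 1) =
      1 / 2 * (1 / ((k.unpair.2 : ℝ) + 1)) := by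
    push_cast
    field_simp
    ring
  rw [e4]
  linarith [hε.2]

/-- For ε = 1/4, any δ admits a rational in [0, 1/2] with value below δ, at distance at least 1/2
from the only zero. -/
lemma not_holds_uniformlyZStable :
    ¬ Holds (UniformlyZStable (interval 0 1) singularMap) := by
  rintro ⟨e, he⟩
  have hε : pos (1 / 4) (Nat.pair (constName (ratCode 1 0 3)) 4) := by
    rw [pos_iff, Nat.unpair_pair]
    refine ⟨?_, by norm_num⟩
    have := real_constName (ratCode 1 0 3)
    rw [rat_ratCode] at this
    convert this using 1
    norm_num
  obtain ⟨b, -, δ, hδ, hb⟩ := he _ _ hε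
  rw [pos_iff] at hδ
  have hδ0 : 0 < δ := lt_trans (by positivity) hδ.2
  obtain ⟨q, h0, h1, hq⟩ := exists_rat_singularMap_lt hδ0
  obtain ⟨c, rfl⟩ := rat_surjective q
  have h0 := (Rat.cast_le (K := ℝ)).2 h0
  have h1 := (Rat.cast_le (K := ℝ)).2 h1
  push_cast at h0 h1
  have hx : interval 0 1 (rat c : ℝ) (Nat.pair (constName c) 0) := by
    rw [interval_iff]
    exact ⟨by simpa only [Nat.unpair_pair] using real_constName c, h0, by linarith⟩
  obtain ⟨d, -, hd⟩ := hb _ _ hx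
  rw [← abs_of_nonneg (singularMap_nonneg _)] at hq
  obtain ⟨m, hm⟩ := exists_lt_iff.2 hq
  obtain ⟨r, -, y, hy, hlt⟩ := hd m hm
  rw [eq_one_of_zeros hy] at hlt
  have := (abs_lt.1 (lt_of_lt hlt)).1
  linarith

end RecursiveModel

theorem mainTheorem11 :
    Holds CMT ∧
    Holds (CMT ⟹
      exist
        (fn (interval 0 (1 / 2)) real) fun g =>
      UniformlyContinuous (interval 0 (1 / 2)) g ⋏
      (forAll (interval 0 (1 / 2)) fun x =>
        lt 0 (g x)) ⋏
      IsInfimum (interval 0 (1 / 2)) g 0 ⋏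
      exist
        (fn (interval 0 1) real) fun f =>
      -- the construction of `f` from `g`
      (forAll (interval 0 1) fun x =>
        le 0 (f x)) ⋏
      (forAll (interval 0 (1 / 2)) fun x =>
        eq (f x) (g x)) ⋏
      eq (f 1) 0 ⋏
      (forAll (interval (1 / 2) 1) fun x =>
        eq (f x) ((2 - 2 * x) * f (1 / 2) + (2 * x - 1) * f 1)) ⋏
      -- the zero set of `f` is `{1}`, inhabited and located
      (forAll real fun x =>
        iff (zeros (interval 0 1) f x)
          (eq x 1)) ⋏
      IsInhabited (zeros (interval 0 1) f) ⋏
      Located (interval 0 1)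
        (zeros (interval 0 1) f) ⋏
      -- `f` is uniformly continuous and Z-stable, but not uniformly Z-stable
      UniformlyContinuous (interval 0 1) f ⋏
      ZStable (interval 0 1) f ⋏
      neg (UniformlyZStable (interval 0 1) f)) := by

  -- The conclusion holds outright, so the realizer of the implication ignores that of CMT.
  refine ⟨holds_CMT, Holds.impl _ ?_⟩
  refine Holds.exist singularMap (effLip_singularMap.holds_fn _ _) ?_
  refine .conj (effLip_singularMap.holds_uniformlyContinuous _) ?_
  refine .conj holds_singularMap_pos ?_
  refine .conj holds_isInfimum_singularMap ?_
  refine Holds.exist singularMap (effLip_singularMap.holds_fn _ _) ?_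
  refine .conj ⟨constName 0, forAll_constName fun x _ _ => le_iff.2 (singularMap_nonneg x)⟩ ?_
  refine .conj ⟨constName 0, forAll_constName fun x _ _ => eq_iff.2 rfl⟩ ?_
  refine .conj ⟨0, eq_iff.2 singularMap_one⟩ ?_
  refine .conj ⟨constName 0, forAll_constName fun x n hx => ?_⟩ ?_
  · rw [interval_iff] at hx
    exact eq_iff.2 (singularMap_eq_linear hx.2.1 hx.2.2)
  refine .conj holds_zeros_iff ?_
  refine .conj ⟨Nat.pair zeroName 0, exist_pair 1 zeros_zeroName trivial⟩ ?_
  refine .conj holds_located ?_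
  refine .conj (effLip_singularMap.holds_uniformlyContinuous _) ?_
  exact .conj holds_zStable ⟨0, neg_iff.2 not_holds_uniformlyZStable⟩
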